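/- For a finite set $X\subseteq \mathbb{F}_2^n$ let $D(X)=\{\operatorname{dist}(x,y): x,y\in X,\ x\neq y\}$, where $\operatorname{dist}(x,y)$ is the Hamming distance, i.e. the number of coordinates in which $x$ and $y$ differ. For a finite set $D$ of positive integers let $A(\mathcal{H}_n,D)$ be the maximum of $|X|$ over all $X\subseteq\mathbb{F}_2^n$ with $D(X)=D$ (and $A(\mathcal{H}_n,D)=0$ if there is no such $X$). Let $t\ge 0$ be an integer; for $t=0$ the set $\{2,4,\dots,2t\}$ is empty. 1. Let $D$ be a fixed set of exactly $t$ positive integers with $D\neq\{2,4,\dots,2t\}$. Then, as $n\to\infty$, $$A(\mathcal{H}_n,D)\le\Bigl(\frac{t}{t+1}+o(1)\Bigr)\binom{n}{t},$$ where the $o(1)$ term is a function of $n$ that tends to $0$ and may depend on $D$. 2. For every $n\ge 2t+2$, $$A\bigl(\mathcal{H}_n,\{2,4,\dots,2t\}\bigr)=\sum_{\substack{0\le i\le t\\ i\equiv t \ (\mathrm{mod}\ 2)}}\binom{n}{i}.$$ -/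

import Mathlib

/-- The vertex set `𝔽₂ⁿ` of the Hamming cube. Distances in it are measured by `hammingDist`, the
number of coordinates in which two strings differ. -/
abbrev HammingCube (n : ℕ) : Type := Fin n → ZMod 2

/-- The distance set `D(X) = {dist(x, y) : x, y ∈ X, x ≠ y}` of a subset `X` of the Hamming cube. -/
def distanceSet {n : ℕ} (X : Finset (HammingCube n)) : Finset ℕ :=
  X.offDiag.image fun p => hammingDist p.1 p.2

/-- `A(Hₙ, D)`: the maximum of `|X|` over all `X` in the Hamming cube with `D(X) = D` exactly.
It is `0` if there is no such `X`. -/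
def maxCodeSize (n : ℕ) (D : Finset ℕ) : ℕ :=
  (Finset.univ.filter fun X : Finset (HammingCube n) => distanceSet X = D).sup Finset.card

/-- The set `{2, 4, …, 2t}`. -/
def firstEvens (t : ℕ) : Finset ℕ :=
  (Finset.Icc 1 t).image fun i => 2 * i

/-!
Codes in the Hamming cube are treated as set families through their supports: the distance of `x`
and `y` is then `#(x ∆ y)`.

**Fixed distance sets.** If some distance is odd, splitting the code by parity leaves two codes
with fewer, even, distances. Otherwise `D = 2 * A` with `A` a set of `t` positive integers, and
the claim is the bound `n ^ t / ∏ A + O(n ^ (t - 1))` (`exists_bound_of_evenDistancesIn`); since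
`A ≠ {1, …, t}` has product at least `(t - 1)! * (t + 1)` (`factorial_succ_card_le_mul_prod`),
this gives the factor `t / (t + 1)`. The bound is proved by induction on `A`, removing its largest
element `m`. Suppose first that, after a translation, the code contains many pairwise disjoint
sets of size `m`. As its diameter is at most `2 * m`, the whole translated code then lies in the
ball of radius `m` about the origin (`HasStar.card_symmDiff_le`). Points of size less than `m` are
never at distance `2 * m` from each other, so by induction there are few of them. Among the
`m`-sets, those through a given point avoid the distance `2 * m`, so by induction there are at
most `n ^ (t - 1) / ∏ (A \ {m}) + …` of them, and counting incidences gains the factor `n / m`. If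
the code contains no such star, a random selection keeps a constant proportion of each layer and
destroys all pairs at distance `2 * m` (`exists_subfamily_avoiding`), so the code has size
`O(n ^ (t - 1))`.

**The distances `2, 4, …, 2 * t`.** The sets of size at most `t` and of the parity of `t` form a
code of the asserted size. For the upper bound consider the polynomial `p d = ∏ 2 * (2 * i - d)`,
`1 ≤ i ≤ t`, which vanishes on all distances of the code. Its coefficient at the Krawtchouk
polynomial `K_{t - j}` has the sign of `(-1) ^ j`, or vanishes, when `n ≥ 2 * t + 2`
(`IsKrawtchoukSeq.prod_eq_sum`, `kleitmanCoeff_nonneg`). A code larger than the number of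
characters of degree at most `t` and of the parity of `t` carries a nonzero weight `w` orthogonal
to all of them. The quadratic form `∑ w x * w y * p #(x ∆ y)` is positive, because only its
diagonal survives, and nonpositive, because only characters with nonpositive coefficients
contribute (`eq_zero_of_orthogonal_parityBall`).
-/

section FewDistances

open Finset
open scoped symmDiff

/-! ### Set families and stars -/

section SetFamilies

variable {α : Type*} [DecidableEq α]

/-- All pairwise distances `#(x ∆ y)` in the set family `F` are of the form `2 * a` with `a ∈ A`.
Set families stand for codes in the Hamming cube, via supports. -/
def EvenDistancesIn (A : Finset ℕ) (F : Finset (Finset α)) : Prop :=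
  ∀ x ∈ F, ∀ y ∈ F, x ≠ y → ∃ a ∈ A, #(x ∆ y) = 2 * a

lemma card_symmDiff_add_two_mul_card_inter (s t : Finset α) :
    #(s ∆ t) + 2 * #(s ∩ t) = #s + #t := by
  have h : #(s ∆ t) = #(s \ t) + #(t \ s) := by
    rw [symmDiff_def, sup_eq_union, card_union_of_disjoint disjoint_sdiff_sdiff]
  have h1 := card_sdiff_add_card_inter s t
  have h2 := card_sdiff_add_card_inter t s
  rw [inter_comm t s] at h2
  omega

lemma card_symmDiff_le (s t : Finset α) : #(s ∆ t) ≤ #s + #t := by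
  have := card_symmDiff_add_two_mul_card_inter s t
  omega

lemma card_symmDiff_of_disjoint {s t : Finset α} (h : Disjoint s t) : #(s ∆ t) = #s + #t := by
  have := card_symmDiff_add_two_mul_card_inter s t
  rw [disjoint_iff_inter_eq_empty.1 h] at this
  simpa using this

lemma symmDiff_symmDiff_symmDiff_left (c x y : Finset α) : (c ∆ x) ∆ (c ∆ y) = x ∆ y := by
  rw [symmDiff_symmDiff_symmDiff_comm, symmDiff_self, bot_symmDiff]

namespace EvenDistancesIn

variable {A B : Finset ℕ} {F G : Finset (Finset α)} {m : ℕ}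

lemma subset (h : EvenDistancesIn A F) (hG : G ⊆ F) : EvenDistancesIn A G :=
  fun x hx y hy hxy => h x (hG hx) y (hG hy) hxy

lemma image_symmDiff (h : EvenDistancesIn A F) (c : Finset α) :
    EvenDistancesIn A (F.image (c ∆ ·)) := by
  intro x' hx' y' hy' hxy
  obtain ⟨x, hx, rfl⟩ := mem_image.1 hx'
  obtain ⟨y, hy, rfl⟩ := mem_image.1 hy'
  rw [symmDiff_symmDiff_symmDiff_left]
  exact h x hx y hy fun e => hxy (by rw [e])

lemma of_insert (h : EvenDistancesIn (insert m B) F)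
    (hF : ∀ x ∈ F, ∀ y ∈ F, x ≠ y → #(x ∆ y) ≠ 2 * m) : EvenDistancesIn B F := by
  intro x hx y hy hxy
  obtain ⟨a, ha, hd⟩ := h x hx y hy hxy
  rcases mem_insert.1 ha with rfl | ha
  · exact absurd hd (hF x hx y hy hxy)
  · exact ⟨a, ha, hd⟩

lemma card_le_one (h : EvenDistancesIn ∅ F) : #F ≤ 1 := by
  refine Finset.card_le_one.2 fun x hx y hy => ?_
  by_contra hxy
  obtain ⟨a, ha, -⟩ := h x hx y hy hxy
  simp at ha

lemma card_symmDiff_le (h : EvenDistancesIn A F) (hA : ∀ a ∈ A, a ≤ m) {x y : Finset α}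
    (hx : x ∈ F) (hy : y ∈ F) : #(x ∆ y) ≤ 2 * m := by
  by_cases hxy : x = y
  · simp [hxy]
  · obtain ⟨a, ha, hd⟩ := h x hx y hy hxy
    have := hA a ha
    omega

end EvenDistancesIn

lemma card_image_symmDiff (F : Finset (Finset α)) (c : Finset α) :
    #(F.image (c ∆ ·)) = #F :=
  card_image_of_injective _ (symmDiff_right_injective c)

/-- The family `F` contains a sunflower with centre `c` and `r` petals of size `m`, up to
translation: the sets `c ∆ P` belong to `F` for `r` pairwise disjoint sets `P` of size `m`. -/
def HasStar (F : Finset (Finset α)) (m r : ℕ) (c : Finset α) : Prop :=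
  ∃ P : Finset (Finset α), #P = r ∧ (∀ p ∈ P, #p = m ∧ c ∆ p ∈ F) ∧
    (P : Set (Finset α)).PairwiseDisjoint id

/-- More than `#z` pairwise disjoint sets cannot all meet `z`. -/
lemma exists_disjoint_of_card_lt {P : Finset (Finset α)}
    (hP : (P : Set (Finset α)).PairwiseDisjoint id) {z : Finset α} (h : #z < #P) :
    ∃ p ∈ P, Disjoint z p := by
  by_contra! hcon
  have h1 : ∀ p ∈ P, 1 ≤ #(z ∩ p) := fun p hp =>
    card_pos.2 (not_disjoint_iff_nonempty_inter.1 (hcon p hp))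
  have h2 : #(P.biUnion fun p => z ∩ p) = ∑ p ∈ P, #(z ∩ p) := by
    refine card_biUnion fun p hp q hq hpq => ?_
    exact (hP hp hq hpq).mono inter_subset_right inter_subset_right
  have h3 : #(P.biUnion fun p => z ∩ p) ≤ #z :=
    card_le_card (biUnion_subset.2 fun p _ => inter_subset_left)
  have h4 := sum_le_sum h1
  simp only [sum_const, smul_eq_mul, mul_one] at h4
  omega

/-- A star with petals of size `m` in a family of diameter `2 * m` forces the whole family into the
ball of radius `m` about its centre: a petal disjoint from `y ∆ c` gives a point at distance
`#(y ∆ c) + m` from `y`. -/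
lemma HasStar.card_symmDiff_le {F : Finset (Finset α)} {m r : ℕ} {c : Finset α}
    (h : HasStar F m r c) (hr : 3 * m < r)
    (hF : ∀ x ∈ F, ∀ y ∈ F, #(x ∆ y) ≤ 2 * m) {y : Finset α} (hy : y ∈ F) :
    #(c ∆ y) ≤ m := by
  obtain ⟨P, hPr, hP, hdis⟩ := h
  obtain ⟨p₀, hp₀⟩ : P.Nonempty := card_pos.1 (by omega)
  have hc : ∀ p, (c ∆ p) ∆ y = (c ∆ y) ∆ p := fun p => symmDiff_right_comm c p y
  have h3 : #(c ∆ y) ≤ 3 * m := by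
    have h1 := hF _ (hP p₀ hp₀).2 y hy
    have h2 := _root_.card_symmDiff_le ((c ∆ p₀) ∆ y) p₀
    rw [hc, symmDiff_symmDiff_cancel_right] at h2
    rw [hc] at h1
    have := (hP p₀ hp₀).1
    omega
  obtain ⟨p, hp, hd⟩ := exists_disjoint_of_card_lt hdis (by omega : #(c ∆ y) < #P)
  have h1 := hF _ (hP p hp).2 y hy
  rw [hc, card_symmDiff_of_disjoint hd, (hP p hp).1] at h1
  omega

/-- A family of `m`-sets without `r` pairwise disjoint members is met by a set of at most `r * m`
points, namely by the union of a maximal disjoint subfamily. -/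
lemma exists_cover_of_no_disjoint (G : Finset (Finset α)) {m r : ℕ} (hm : 0 < m)
    (hG : ∀ p ∈ G, #p = m)
    (hr : ∀ P ⊆ G, (P : Set (Finset α)).PairwiseDisjoint id → #P ≠ r) :
    ∃ T : Finset α, #T ≤ r * m ∧ ∀ p ∈ G, (p ∩ T).Nonempty := by
  classical
  obtain ⟨P, hP, hmax⟩ := exists_max_image
    (G.powerset.filter fun P : Finset (Finset α) => (P : Set (Finset α)).PairwiseDisjoint id) card
    ⟨∅, by simp⟩
  simp only [mem_filter, mem_powerset] at hP hmax
  have hlt : #P < r := by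
    by_contra! hle
    obtain ⟨Q, hQ, hQr⟩ := exists_subset_card_eq hle
    exact hr Q (hQ.trans hP.1) (hP.2.subset (by exact_mod_cast hQ)) hQr
  refine ⟨P.biUnion id, ?_, fun p hp => ?_⟩
  · exact (card_biUnion_le_card_mul P id m fun p hp => (hG p (hP.1 hp)).le).trans
      (Nat.mul_le_mul_right m hlt.le)
  · by_contra hne
    rw [← not_disjoint_iff_nonempty_inter, not_not, disjoint_biUnion_right] at hne
    by_cases hpP : p ∈ P
    · have h1 := hne p hpP
      simp only [id, disjoint_self, bot_eq_empty] at h1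
      have := hG p hp
      simp [h1] at this
      omega
    · have h1 := hmax (insert p P) ⟨insert_subset hp hP.1, by
        rw [coe_insert]
        exact hP.2.insert fun q hq _ => hne q hq⟩
      rw [card_insert_of_notMem hpP] at h1
      omega

/-- Random selection. If every `x ∈ F` carries at most `N` constraints `s ∈ B x`, each of which is
satisfied by at least one of the at most `q` values in `T s`, then some assignment `g` of values
satisfies all constraints of a `q ^ (-N)` proportion of `F`: average over all `g`. -/
lemma exists_assignment {β σ τ : Type*} [Fintype σ]
    (F : Finset β) (B : β → Finset σ) (T : σ → Finset τ) (R : β → σ → τ → Prop)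
    {N q : ℕ} (hq0 : 0 < q)
    (hB : ∀ x ∈ F, #(B x) ≤ N) (hT : ∀ s, (T s).Nonempty) (hq : ∀ s, #(T s) ≤ q)
    (hR : ∀ x ∈ F, ∀ s ∈ B x, ∃ v ∈ T s, R x s v) :
    ∃ g : σ → τ, ∃ G ⊆ F, (∀ x ∈ G, ∀ s ∈ B x, R x s (g s)) ∧ #F ≤ q ^ N * #G := by
  classical
  have key : ∀ x ∈ F, ∏ s, #(T s) ≤
      q ^ N * #((Fintype.piFinset T).filter fun g => ∀ s ∈ B x, R x s (g s)) := by
    intro x hx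
    have hR' : ∀ s, ∃ v, s ∈ B x → v ∈ T s ∧ R x s v := fun s => by
      by_cases hs : s ∈ B x
      · obtain ⟨v, hv⟩ := hR x hx s hs
        exact ⟨v, fun _ => hv⟩
      · exact ⟨(hT s).choose, fun h => absurd h hs⟩
    choose v hv using hR'
    have hsub : Fintype.piFinset (fun s => if s ∈ B x then {v s} else T s) ⊆
        (Fintype.piFinset T).filter fun g => ∀ s ∈ B x, R x s (g s) := by
      intro g hg
      rw [Fintype.mem_piFinset] at hg
      refine mem_filter.2 ⟨Fintype.mem_piFinset.2 fun s => ?_, fun s hs => ?_⟩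
      · have := hg s
        split_ifs at this with hs
        · rw [mem_singleton.1 this]
          exact (hv s hs).1
        · exact this
      · have := hg s
        rw [if_pos hs, mem_singleton] at this
        rw [this]
        exact (hv s hs).2
    refine le_trans ?_ (Nat.mul_le_mul_left _ (card_le_card hsub))
    rw [Fintype.card_piFinset]
    calc ∏ s, #(T s)
        ≤ ∏ s, ((if s ∈ B x then q else 1) * #(if s ∈ B x then {v s} else T s)) := by
          refine prod_le_prod' fun s _ => ?_
          split_ifs with hs
          · simpa using hq s
          · simp
      _ = q ^ #(B x) * ∏ s, #(if s ∈ B x then {v s} else T s) := by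
          rw [prod_mul_distrib, prod_ite_mem, univ_inter, prod_const]
      _ ≤ _ := by
          exact Nat.mul_le_mul_right _ (Nat.pow_le_pow_right hq0 (hB x hx))
  have hsum := sum_le_sum key
  rw [← mul_sum] at hsum
  have hswap := sum_card_bipartiteAbove_eq_sum_card_bipartiteBelow
    (s := F) (t := Fintype.piFinset T) (fun x g => ∀ s ∈ B x, R x s (g s))
  simp only [bipartiteAbove, bipartiteBelow] at hswap
  rw [hswap, sum_const, smul_eq_mul, mul_sum] at hsum
  by_contra! hcon
  have hlt := sum_lt_sum_of_nonempty (Fintype.piFinset_nonempty.2 hT) fun g _ =>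
    hcon g (F.filter fun x => ∀ s ∈ B x, R x s (g s)) (filter_subset _ _)
      fun x hx => (mem_filter.1 hx).2
  rw [sum_const, smul_eq_mul, Fintype.card_piFinset, mul_comm] at hlt
  omega

end SetFamilies

/-! ### The asymptotic bound for even distances -/

section SetFamilies

variable {α : Type*} [DecidableEq α]

/-- A `k`-uniform family without a star of `r` petals of size `m` contains a subfamily of constant
proportion in which the distance `2 * m` does not occur. Sets at distance `2 * m` meet in a set `s`
of size `k - m`; the members of `F` containing `s` are all met outside `s` by a bounded set, and
one keeps only those that contain a chosen point of this set, for every such `s`. -/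
lemma exists_subfamily_avoiding [Fintype α] [Nonempty α] {F : Finset (Finset α)} {k m r : ℕ}
    (hm : 0 < m) (hF : ∀ x ∈ F, #x = k) (hstar : ∀ c, ¬ HasStar F m r c) :
    ∃ G ⊆ F, #F ≤ (r * m + 1) ^ 2 ^ k * #G ∧ ∀ x ∈ G, ∀ y ∈ G, x ≠ y → #(x ∆ y) ≠ 2 * m := by
  classical
  have hcov : ∀ s : Finset α, ∃ T : Finset α, T.Nonempty ∧ #T ≤ r * m + 1 ∧
      ∀ x ∈ F, s ⊆ x → #(x \ s) = m → ∃ v ∈ T, v ∈ x \ s := by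
    intro s
    obtain ⟨T, hT, hmeet⟩ := exists_cover_of_no_disjoint (m := m) (r := r)
      ((F.filter fun x => s ⊆ x ∧ #(x \ s) = m).image (· \ s)) hm
      (by
        intro p hp
        obtain ⟨x, hx, rfl⟩ := mem_image.1 hp
        exact (mem_filter.1 hx).2.2)
      (by
        intro P hP hdis hPr
        refine hstar s ⟨P, hPr, fun p hp => ?_, hdis⟩
        obtain ⟨x, hx, rfl⟩ := mem_image.1 (hP hp)
        obtain ⟨hxF, hsx, hxm⟩ := mem_filter.1 hx
        refine ⟨hxm, ?_⟩
        have : s ∆ (x \ s) = x := by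
          rw [disjoint_sdiff.symmDiff_eq_sup, sup_eq_union, union_sdiff_of_subset hsx]
        rwa [this])
    obtain ⟨v₀⟩ := ‹Nonempty α›
    -- the extra point `v₀` only serves to make the set of values nonempty
    refine ⟨insert v₀ T, insert_nonempty _ _, (card_insert_le _ _).trans (by omega), ?_⟩
    intro x hx hsx hxm
    obtain ⟨v, hv⟩ := hmeet (x \ s) (mem_image.2 ⟨x, mem_filter.2 ⟨hx, hsx, hxm⟩, rfl⟩)
    rw [mem_inter] at hv
    exact ⟨v, mem_insert_of_mem hv.2, hv.1⟩
  choose T hT0 hTq hT using hcov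
  obtain ⟨g, G, hGF, hgG, hcard⟩ := exists_assignment F
    (fun x => x.powerset.filter fun s => #(x \ s) = m) T
    (fun x s v => v ∈ x \ s) (N := 2 ^ k) (q := r * m + 1) (Nat.succ_pos _)
    (fun x hx => (card_filter_le _ _).trans (by rw [card_powerset, hF x hx]))
    hT0 hTq
    (fun x hx s hs => by
      rw [mem_filter, mem_powerset] at hs
      exact hT s x hx hs.1 hs.2)
  refine ⟨G, hGF, hcard, fun x hx y hy _ hd => ?_⟩
  have hxy := card_symmDiff_add_two_mul_card_inter x y
  have h1 := card_sdiff_add_card_inter x y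
  have h2 := card_sdiff_add_card_inter y x
  rw [inter_comm y x] at h2
  have hkx := hF x (hGF hx)
  have hky := hF y (hGF hy)
  have hgx := hgG x hx (x ∩ y) (by
    rw [mem_filter, mem_powerset, sdiff_inter_self_left]
    exact ⟨inter_subset_left, by omega⟩)
  have hgy := hgG y hy (x ∩ y) (by
    rw [mem_filter, mem_powerset, sdiff_inter_self_right]
    exact ⟨inter_subset_right, by omega⟩)
  rw [mem_sdiff] at hgx hgy
  exact hgx.2 (mem_inter.2 ⟨hgx.1, hgy.1⟩)

/-- Double counting in an `m`-uniform family in terms of the degrees of the points. -/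
lemma sum_degree_eq [Fintype α] {F : Finset (Finset α)} {m : ℕ} (hF : ∀ x ∈ F, #x = m) :
    ∑ i, #(F.filter fun x => i ∈ x) = m * #F := by
  have h := sum_card_bipartiteAbove_eq_sum_card_bipartiteBelow
    (s := F) (t := (univ : Finset α)) (fun x i => i ∈ x)
  simp only [bipartiteAbove, bipartiteBelow, filter_univ_mem] at h
  rw [← h, sum_congr rfl hF, sum_const, smul_eq_mul, mul_comm]

/-- In an `m`-uniform family two members sharing a point are at distance less than `2 * m`. -/
lemma EvenDistancesIn.filter_mem {B : Finset ℕ} {F : Finset (Finset α)} {m : ℕ}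
    (h : EvenDistancesIn (insert m B) F) (hF : ∀ x ∈ F, #x = m) (i : α) :
    EvenDistancesIn B (F.filter fun x => i ∈ x) := by
  refine (h.subset (filter_subset _ _)).of_insert fun x hx y hy _ hd => ?_
  rw [mem_filter] at hx hy
  have h1 := card_symmDiff_add_two_mul_card_inter x y
  have h2 : 0 < #(x ∩ y) := card_pos.2 ⟨i, mem_inter.2 ⟨hx.2, hy.2⟩⟩
  rw [hF x hx.1, hF y hy.1] at h1
  omega

lemma EvenDistancesIn.filter_card_lt {B : Finset ℕ} {F : Finset (Finset α)} {m : ℕ}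
    (h : EvenDistancesIn (insert m B) F) :
    EvenDistancesIn B (F.filter fun x => #x < m) := by
  refine (h.subset (filter_subset _ _)).of_insert fun x hx y hy _ hd => ?_
  rw [mem_filter] at hx hy
  have := _root_.card_symmDiff_le x y
  omega

end SetFamilies

/-- If the bound with main term `n ^ #A / ∏ A` holds, then so does a bound of order `n ^ #A`. -/
lemma exists_crude_bound {A : Finset ℕ} (hA : ∀ a ∈ A, 0 < a)
    (h : ∃ C, ∀ (n : ℕ) (F : Finset (Finset (Fin n))), EvenDistancesIn A F →
      n * (#F * ∏ a ∈ A, a) ≤ n ^ (#A + 1) + C * n ^ #A) :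
    ∃ K, ∀ (n : ℕ), 0 < n → ∀ F : Finset (Finset (Fin n)), EvenDistancesIn A F →
      #F ≤ K * n ^ #A := by
  obtain ⟨C, hC⟩ := h
  refine ⟨C + 1, fun n hn F hF => ?_⟩
  have h1 := hC n F hF
  have h2 : 1 ≤ ∏ a ∈ A, a := prod_pos hA
  refine Nat.le_of_mul_le_mul_left ?_ hn
  calc n * #F ≤ n * (#F * ∏ a ∈ A, a) := by
        gcongr
        exact Nat.le_mul_of_pos_right _ h2
    _ ≤ n ^ (#A + 1) + C * n ^ #A := h1
    _ ≤ n ^ (#A + 1) + C * n ^ (#A + 1) := by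
        gcongr
        omega
    _ = n * ((C + 1) * n ^ #A) := by ring

/-- A set family on `n` points with `t` nonzero distances `2 * a`, `a ∈ A`, has at most
`n ^ t / ∏ A + O(n ^ (t - 1))` members (here multiplied by `n * ∏ A`). Induction on `A`, removing
the largest element `m`. Either there is a star with many petals of size `m`; then all but
`O(n ^ (t - 1))` members are at distance exactly `m` from its centre and one counts degrees. Or
there is none, and a constant proportion of each layer avoids the distance `2 * m`. -/
theorem exists_bound_of_evenDistancesIn (A : Finset ℕ) (hA : ∀ a ∈ A, 0 < a) :
    ∃ C, ∀ (n : ℕ) (F : Finset (Finset (Fin n))), EvenDistancesIn A F →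
      n * (#F * ∏ a ∈ A, a) ≤ n ^ (#A + 1) + C * n ^ #A := by
  classical
  induction A using Finset.induction_on_max with
  | empty =>
    refine ⟨0, fun n F hF => ?_⟩
    simpa using Nat.mul_le_mul_left n hF.card_le_one
  | insert m B hmB ih =>
    have hB : ∀ a ∈ B, 0 < a := fun a ha => hA a (mem_insert_of_mem ha)
    have hm : 0 < m := hA m (mem_insert_self _ _)
    have hmnot : m ∉ B := fun h => lt_irrefl _ (hmB m h)
    have hle : ∀ a ∈ insert m B, a ≤ m := by
      intro a ha
      rcases mem_insert.1 ha with rfl | ha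
      · exact le_rfl
      · exact (hmB a ha).le
    specialize ih hB
    obtain ⟨K, hK⟩ := exists_crude_bound hB ih
    obtain ⟨C, hC⟩ := ih
    rw [card_insert_of_notMem hmnot, prod_insert hmnot]
    set t := #B
    set Q := ∏ a ∈ B, a
    set r := 3 * m + 1
    -- the bound in the absence of a star, summed over all layers of size at most `2 * m`
    set K' := (2 * m + 1) * ((r * m + 1) ^ 2 ^ (2 * m) * K)
    refine ⟨C + (K + K') * (m * Q), fun n F hF => ?_⟩
    rcases Nat.eq_zero_or_pos n with rfl | hn
    · simp
    rcases F.eq_empty_or_nonempty with rfl | ⟨x₀, hx₀⟩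
    · simp
    by_cases hstar : ∃ c, HasStar F m r c
    · obtain ⟨c, hc⟩ := hstar
      set F' := F.image (c ∆ ·)
      have hF' : EvenDistancesIn (insert m B) F' := hF.image_symmDiff c
      have hball : ∀ x ∈ F', #x ≤ m := by
        intro x hx
        obtain ⟨y, hy, rfl⟩ := mem_image.1 hx
        exact hc.card_symmDiff_le (by omega)
          (fun x hx y hy => hF.card_symmDiff_le hle hx hy) hy
      have hsplit : #F = #(F'.filter fun x => #x < m) + #(F'.filter fun x => #x = m) := by
        rw [← card_image_symmDiff F c, ← card_filter_add_card_filter_not (fun x => #x < m)]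
        congr 2
        refine filter_congr fun x hx => ?_
        have := hball x hx
        omega
      have hlow := hK n hn _ hF'.filter_card_lt
      set Y := F'.filter fun x => #x = m
      have hYF : EvenDistancesIn (insert m B) Y := hF'.subset (filter_subset _ _)
      have hYm : ∀ x ∈ Y, #x = m := fun x hx => (mem_filter.1 hx).2
      have hY : n * (#Y * (m * Q)) ≤ n ^ (t + 2) + C * n ^ (t + 1) :=
        calc n * (#Y * (m * Q)) = ∑ i : Fin n, n * (#(Y.filter fun x => i ∈ x) * Q) := by
              rw [← mul_sum, ← sum_mul, sum_degree_eq hYm]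
              ring
          _ ≤ ∑ _i : Fin n, (n ^ (t + 1) + C * n ^ t) :=
              sum_le_sum fun i _ => hC n _ (hYF.filter_mem hYm i)
          _ = n ^ (t + 2) + C * n ^ (t + 1) := by
              rw [sum_const, card_univ, Fintype.card_fin, smul_eq_mul]
              ring
      calc n * (#F * (m * Q))
          = n * (#Y * (m * Q)) + n * (m * Q) * #(F'.filter fun x => #x < m) := by
            rw [hsplit]
            ring
        _ ≤ (n ^ (t + 2) + C * n ^ (t + 1)) + n * (m * Q) * (K * n ^ t) := by gcongr
        _ = n ^ (t + 1 + 1) + (C + K * (m * Q)) * n ^ (t + 1) := by ring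
        _ ≤ _ := by
            gcongr
            omega
    · -- translated by a member of `F`, the family consists of sets of size at most `2 * m`
      set F' := F.image (x₀ ∆ ·)
      have hF' : EvenDistancesIn (insert m B) F' := hF.image_symmDiff x₀
      have hball : ∀ x ∈ F', #x ∈ range (2 * m + 1) := by
        intro x hx
        obtain ⟨y, hy, rfl⟩ := mem_image.1 hx
        have := hF.card_symmDiff_le hle hx₀ hy
        rw [mem_range]
        omega
      have hstar' : ∀ c, ¬ HasStar F' m r c := by
        rintro c ⟨P, hPr, hP, hdis⟩
        refine hstar ⟨x₀ ∆ c, P, hPr, fun p hp => ⟨(hP p hp).1, ?_⟩, hdis⟩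
        obtain ⟨y, hy, hyc⟩ := mem_image.1 (hP p hp).2
        rw [symmDiff_assoc, ← hyc, symmDiff_symmDiff_cancel_left]
        exact hy
      have hlayer : ∀ k ∈ range (2 * m + 1), #(F'.filter fun x => #x = k) ≤
          (r * m + 1) ^ 2 ^ (2 * m) * K * n ^ t := by
        intro k hk
        have : Nonempty (Fin n) := ⟨⟨0, hn⟩⟩
        obtain ⟨G, hGF, hcard, hG⟩ := exists_subfamily_avoiding (r := r) hm
          (F := F'.filter fun x => #x = k) (fun x hx => (mem_filter.1 hx).2)
          (fun c ⟨P, hPr, hP, hdis⟩ => hstar' c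
            ⟨P, hPr, fun p hp => ⟨(hP p hp).1, (mem_filter.1 (hP p hp).2).1⟩, hdis⟩)
        have hGB : EvenDistancesIn B G :=
          (hF'.subset (hGF.trans (filter_subset _ _))).of_insert hG
        rw [mem_range] at hk
        calc _ ≤ _ := hcard
          _ ≤ (r * m + 1) ^ 2 ^ (2 * m) * (K * n ^ t) := by
              gcongr
              · omega
              · omega
              · omega
              · exact hK n hn G hGB
          _ = _ := by ring
      have hF'card : #F ≤ K' * n ^ t := by
        rw [← card_image_symmDiff F x₀, card_eq_sum_card_fiberwise hball]
        refine (sum_le_sum hlayer).trans (le_of_eq ?_)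
        rw [sum_const, card_range, smul_eq_mul]
        ring
      calc n * (#F * (m * Q)) ≤ n * (K' * n ^ t * (m * Q)) := by gcongr
        _ = K' * (m * Q) * n ^ (t + 1) := by ring
        _ ≤ (C + (K + K') * (m * Q)) * n ^ (t + 1) := by
            gcongr
            nlinarith [Nat.zero_le (K * (m * Q))]
        _ ≤ _ := Nat.le_add_left _ _

/-! ### Codes as set families -/

section Supports

/-- The support of a point of the Hamming cube. -/
def cubeSupport {n : ℕ} (x : HammingCube n) : Finset (Fin n) :=
  univ.filter fun i => x i ≠ 0

lemma cubeSupport_injective (n : ℕ) : Function.Injective (cubeSupport (n := n)) := by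
  intro x y h
  funext i
  have h1 : x i ≠ 0 ↔ y i ≠ 0 := by
    have := congrArg (i ∈ ·) h
    simpa [cubeSupport, not_iff_not] using this
  generalize x i = a at h1 ⊢
  generalize y i = b at h1 ⊢
  revert a b
  decide

lemma cubeSupport_surjective (n : ℕ) : Function.Surjective (cubeSupport (n := n)) := by
  intro s
  refine ⟨fun i => if i ∈ s then 1 else 0, ?_⟩
  ext i
  simp [cubeSupport]

lemma hammingDist_eq_card_symmDiff {n : ℕ} (x y : HammingCube n) :
    hammingDist x y = #(cubeSupport x ∆ cubeSupport y) := by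
  rw [hammingDist]
  congr 1
  ext i
  simp only [cubeSupport, mem_filter, mem_univ, true_and, mem_symmDiff]
  generalize x i = a
  generalize y i = b
  revert a b
  decide

lemma card_image_cubeSupport {n : ℕ} (X : Finset (HammingCube n)) :
    #(X.image cubeSupport) = #X :=
  card_image_of_injective _ (cubeSupport_injective n)

lemma hammingDist_mem_of_distanceSet_eq {n : ℕ} {X : Finset (HammingCube n)} {D : Finset ℕ}
    (h : distanceSet X = D) {x y : HammingCube n} (hx : x ∈ X) (hy : y ∈ X) (hxy : x ≠ y) :
    hammingDist x y ∈ D := by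
  rw [← h]
  exact mem_image.2 ⟨(x, y), mem_offDiag.2 ⟨hx, hy, hxy⟩, rfl⟩

lemma card_symmDiff_mem_of_distanceSet_eq {n : ℕ} {X : Finset (HammingCube n)} {D : Finset ℕ}
    (h : distanceSet X = D) {x y : Finset (Fin n)} (hx : x ∈ X.image cubeSupport)
    (hy : y ∈ X.image cubeSupport) (hxy : x ≠ y) : #(x ∆ y) ∈ D := by
  obtain ⟨a, ha, rfl⟩ := mem_image.1 hx
  obtain ⟨b, hb, rfl⟩ := mem_image.1 hy
  rw [← hammingDist_eq_card_symmDiff]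
  exact hammingDist_mem_of_distanceSet_eq h ha hb fun e => hxy (by rw [e])

lemma evenDistancesIn_of_even {n : ℕ} {X : Finset (HammingCube n)} {D : Finset ℕ}
    (h : distanceSet X = D) {F : Finset (Finset (Fin n))} (hF : F ⊆ X.image cubeSupport)
    (heven : ∀ x ∈ F, ∀ y ∈ F, Even #(x ∆ y)) :
    EvenDistancesIn ((D.filter Even).image (· / 2)) F := by
  intro x hx y hy hxy
  have he := heven x hx y hy
  refine ⟨#(x ∆ y) / 2, mem_image.2 ⟨_, mem_filter.2
    ⟨card_symmDiff_mem_of_distanceSet_eq h (hF hx) (hF hy) hxy, he⟩, rfl⟩, ?_⟩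
  have := Nat.even_iff.1 he
  omega

end Supports

/-! ### Products of distance sets -/

section DistanceProducts

lemma factorial_card_le_prod (A : Finset ℕ) (hA : ∀ a ∈ A, 0 < a) :
    (#A).factorial ≤ ∏ a ∈ A, a := by
  induction A using Finset.induction_on_max with
  | empty => simp
  | insert m B hmB ih =>
    have hm : m ∉ B := fun h => lt_irrefl _ (hmB m h)
    rw [card_insert_of_notMem hm, prod_insert hm, Nat.factorial_succ]
    refine Nat.mul_le_mul ?_ (ih fun a ha => hA a (mem_insert_of_mem ha))
    have hsub : insert m B ⊆ Icc 1 m := by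
      intro a ha
      refine mem_Icc.2 ⟨hA a ha, ?_⟩
      rcases mem_insert.1 ha with rfl | ha
      · exact le_rfl
      · exact (hmB a ha).le
    have := card_le_card hsub
    rw [card_insert_of_notMem hm, Nat.card_Icc] at this
    omega

/-- A set of `t` positive integers other than `{1, …, t}` has an element `≥ t + 1`, hence product at
least `(t + 1) * (t - 1)!`. -/
lemma factorial_succ_card_le_mul_prod {A : Finset ℕ} (hA : ∀ a ∈ A, 0 < a)
    (hne : A ≠ Icc 1 #A) : (#A + 1).factorial ≤ #A * ∏ a ∈ A, a := by
  obtain ⟨m, hmA, hm⟩ : ∃ m ∈ A, #A < m := by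
    by_contra! hcon
    exact hne (eq_of_subset_of_card_le (fun a ha => mem_Icc.2 ⟨hA a ha, hcon a ha⟩)
      (by rw [Nat.card_Icc]; omega))
  have h1 := factorial_card_le_prod (A.erase m) fun a ha => hA a (mem_of_mem_erase ha)
  have h2 := card_erase_add_one hmA
  rw [← mul_prod_erase A (fun a => a) hmA, ← h2, Nat.factorial_succ, Nat.factorial_succ]
  calc (#(A.erase m) + 1 + 1) * ((#(A.erase m) + 1) * (#(A.erase m)).factorial)
      = (#(A.erase m) + 1) * ((#(A.erase m) + 1 + 1) * (#(A.erase m)).factorial) := by ring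
    _ ≤ _ := by
        gcongr
        omega

end DistanceProducts

/-! ### Codes with a fixed distance set -/

section FixedDistances

lemma exists_card_bound_of_all_even {D : Finset ℕ} (hD : ∀ d ∈ D, 0 < d)
    (hne : D ≠ firstEvens #D) (heven : ∀ d ∈ D, Even d) :
    ∃ C : ℕ, ∀ n : ℕ, 0 < n → ∀ X : Finset (HammingCube n), distanceSet X = D →
      #X * (#D + 1).factorial ≤ #D * (n ^ #D + C * n ^ (#D - 1)) := by
  set A := (D.filter Even).image (· / 2) with hAdef
  have hDA : D = A.image (2 * ·) := by
    rw [hAdef, filter_true_of_mem heven, image_image]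
    conv_lhs => rw [← image_id (s := D)]
    refine image_congr fun d hd => ?_
    have := Nat.even_iff.1 (heven d hd)
    simp only [id, Function.comp]
    omega
  have hcard : #D = #A := by
    conv_lhs => rw [hDA]
    exact card_image_of_injective _ fun a b h => by omega
  have hA : ∀ a ∈ A, 0 < a := by
    intro a ha
    have := hD (2 * a) (by rw [hDA]; exact mem_image_of_mem _ ha)
    omega
  have hAne : A ≠ Icc 1 #A := by
    intro h
    apply hne
    rw [hcard, firstEvens, ← h]
    exact hDA
  have hpos : 0 < #A := by
    rw [card_pos, nonempty_iff_ne_empty]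
    rintro h
    exact hAne (by simp [h])
  obtain ⟨C, hC⟩ := exists_bound_of_evenDistancesIn A hA
  refine ⟨C, fun n hn X hX => ?_⟩
  have h1 := hC n (X.image cubeSupport) (evenDistancesIn_of_even hX subset_rfl
    fun x hx y hy => by
      by_cases hxy : x = y
      · simp [hxy]
      · exact heven _ (card_symmDiff_mem_of_distanceSet_eq hX hx hy hxy))
  rw [card_image_cubeSupport] at h1
  have h2 := factorial_succ_card_le_mul_prod hA hAne
  rw [hcard]
  obtain ⟨s, hs⟩ : ∃ s, #A = s + 1 := ⟨#A - 1, by omega⟩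
  rw [hs] at h1 h2 ⊢
  have h3 : #X * ∏ a ∈ A, a ≤ n ^ (s + 1) + C * n ^ s := by
    refine Nat.le_of_mul_le_mul_left (h1.trans (le_of_eq ?_)) hn
    ring
  calc #X * (s + 1 + 1).factorial ≤ #X * ((s + 1) * ∏ a ∈ A, a) := by gcongr
    _ = (s + 1) * (#X * ∏ a ∈ A, a) := by ring
    _ ≤ _ := by
        gcongr
        exact h3

/-- If some distance is odd, splitting a code by parity leaves two codes with fewer, even,
distances. -/
lemma exists_card_bound_of_odd {D : Finset ℕ} (hD : ∀ d ∈ D, 0 < d)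
    (hodd : ∃ d ∈ D, ¬ Even d) :
    ∃ C : ℕ, ∀ n : ℕ, 0 < n → ∀ X : Finset (HammingCube n), distanceSet X = D →
      #X ≤ C * n ^ (#D - 1) := by
  obtain ⟨d, hd, hdodd⟩ := hodd
  set A := (D.filter Even).image (· / 2) with hAdef
  have hA : ∀ a ∈ A, 0 < a := by
    intro a ha
    obtain ⟨e, he, rfl⟩ := mem_image.1 ha
    rw [mem_filter, Nat.even_iff] at he
    have := hD e he.1
    omega
  have hcard : #A ≤ #D - 1 := by
    refine card_image_le.trans (Nat.le_sub_one_of_lt (card_lt_card ?_))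
    exact (filter_ssubset).2 ⟨d, hd, hdodd⟩
  obtain ⟨K, hK⟩ := exists_crude_bound hA (exists_bound_of_evenDistancesIn A hA)
  refine ⟨2 * K, fun n hn X hX => ?_⟩
  set F := X.image cubeSupport with hFdef
  have hpow : K * n ^ #A ≤ K * n ^ (#D - 1) := by gcongr
  have hpar : ∀ G ⊆ F, (∀ x ∈ G, ∀ y ∈ G, (Even #x ↔ Even #y)) → #G ≤ K * n ^ (#D - 1) := by
    intro G hGF hG
    refine (hK n hn G (evenDistancesIn_of_even hX hGF fun x hx y hy => ?_)).trans hpow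
    have h1 := card_symmDiff_add_two_mul_card_inter x y
    have h2 := hG x hx y hy
    rw [Nat.even_iff, Nat.even_iff] at h2
    rw [Nat.even_iff]
    omega
  have h0 := hpar (F.filter fun x => Even #x) (filter_subset _ _) fun x hx y hy =>
    iff_of_true (mem_filter.1 hx).2 (mem_filter.1 hy).2
  have h1 := hpar (F.filter fun x => ¬ Even #x) (filter_subset _ _) fun x hx y hy =>
    iff_of_false (mem_filter.1 hx).2 (mem_filter.1 hy).2
  have h2 := card_filter_add_card_filter_not (s := F) (fun x => Even #x)
  rw [hFdef, card_image_cubeSupport] at h2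
  rw [← hFdef] at h2
  rw [mul_assoc]
  omega

lemma exists_maxCodeSize_bound {t : ℕ} {D : Finset ℕ} (hD : ∀ d ∈ D, 0 < d) (ht : #D = t)
    (hne : D ≠ firstEvens t) :
    ∃ C : ℝ, ∀ n : ℕ, 0 < n →
      (maxCodeSize n D : ℝ) ≤ (t : ℝ) / (t + 1) * ((n : ℝ) ^ t / t.factorial) +
        C * (n : ℝ) ^ (t - 1) := by
  subst ht
  set t := #D
  have hf : (0 : ℝ) < t.factorial := by exact_mod_cast t.factorial_pos
  have hmax : ∀ n : ℕ, ∃ X : Finset (HammingCube n),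
      maxCodeSize n D = #X ∧ (distanceSet X = D ∨ #X = 0) := by
    intro n
    rcases (univ.filter fun X : Finset (HammingCube n) => distanceSet X = D).eq_empty_or_nonempty
      with h | h
    · refine ⟨∅, ?_, Or.inr rfl⟩
      rw [maxCodeSize, h]
      rfl
    · obtain ⟨X, hX, hXm⟩ := exists_mem_eq_sup _ h card
      exact ⟨X, hXm, Or.inl (mem_filter.1 hX).2⟩
  by_cases heven : ∀ d ∈ D, Even d
  · obtain ⟨C, hC⟩ := exists_card_bound_of_all_even hD hne heven
    refine ⟨t / (t + 1) * (C / t.factorial), fun n hn => ?_⟩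
    obtain ⟨X, hXm, hX | hX⟩ := hmax n
    · have h1 : ((#X * (t + 1).factorial : ℕ) : ℝ) ≤ ((t * (n ^ t + C * n ^ (t - 1)) : ℕ) : ℝ) :=
        Nat.cast_le.2 (hC n hn X hX)
      rw [Nat.factorial_succ] at h1
      push_cast at h1
      rw [hXm]
      have h2 : (t : ℝ) / (t + 1) * ((n : ℝ) ^ t / t.factorial) +
          t / (t + 1) * (C / t.factorial) * (n : ℝ) ^ (t - 1) =
          (t * ((n : ℝ) ^ t + C * (n : ℝ) ^ (t - 1))) / ((t + 1) * t.factorial) := by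
        field_simp
      rw [h2, le_div_iff₀ (by positivity)]
      exact h1
    · rw [hXm, hX, Nat.cast_zero]
      positivity
  · push Not at heven
    obtain ⟨C, hC⟩ := exists_card_bound_of_odd hD (by simpa using heven)
    refine ⟨C, fun n hn => ?_⟩
    have h0 : (0 : ℝ) ≤ (t : ℝ) / (t + 1) * ((n : ℝ) ^ t / t.factorial) := by positivity
    obtain ⟨X, hXm, hX | hX⟩ := hmax n
    · have h1 : ((#X : ℕ) : ℝ) ≤ ((C * n ^ (t - 1) : ℕ) : ℝ) := Nat.cast_le.2 (hC n hn X hX)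
      push_cast at h1
      rw [hXm]
      linarith
    · rw [hXm, hX, Nat.cast_zero]
      positivity

open Filter Asymptotics in
lemma tendsto_pow_div_choose (t : ℕ) :
    Tendsto (fun n : ℕ => (n : ℝ) ^ t / (n.choose t : ℝ)) atTop (nhds (t.factorial : ℝ)) := by
  have hf : (t.factorial : ℝ) ≠ 0 := by exact_mod_cast t.factorial_ne_zero
  have hne : ∀ᶠ n : ℕ in atTop, ((n : ℝ) ^ t / t.factorial) ≠ 0 := by
    filter_upwards [eventually_gt_atTop 0] with n hn
    positivity
  have h := (isEquivalent_iff_tendsto_one hne).1 (isEquivalent_choose t)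
  have h2 := (h.inv₀ one_ne_zero).mul_const (t.factorial : ℝ)
  rw [inv_one, one_mul] at h2
  refine h2.congr' (Eventually.of_forall fun n => ?_)
  simp only [Pi.div_apply, inv_div]
  field_simp

open Filter in
lemma exists_maxCodeSize_asymptotic_bound {t : ℕ} {D : Finset ℕ} (hD : ∀ d ∈ D, 0 < d)
    (ht : #D = t) (hne : D ≠ firstEvens t) :
    ∃ ε : ℕ → ℝ, Tendsto ε atTop (nhds 0) ∧ ∀ᶠ n : ℕ in atTop,
      (maxCodeSize n D : ℝ) ≤ ((t : ℝ) / ((t : ℝ) + 1) + ε n) * (n.choose t : ℝ) := by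
  obtain ⟨C, hC⟩ := exists_maxCodeSize_bound hD ht hne
  have ht0 : 0 < t := by
    rcases Nat.eq_zero_or_pos t with rfl | h
    · exact absurd (card_eq_zero.1 ht) hne
    · exact h
  have hf : (t.factorial : ℝ) ≠ 0 := by exact_mod_cast t.factorial_ne_zero
  have hlim := tendsto_pow_div_choose t
  refine ⟨fun n => (t : ℝ) / (t + 1) *
    ((n : ℝ) ^ t / (n.choose t : ℝ) / t.factorial - 1) +
    C * ((n : ℝ) ^ t / (n.choose t : ℝ) * (n : ℝ)⁻¹), ?_, ?_⟩
  · have h1 := ((hlim.div_const (t.factorial : ℝ)).sub_const 1).const_mul ((t : ℝ) / (t + 1))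
    have h2 := (hlim.mul (tendsto_inv_atTop_nhds_zero_nat (𝕜 := ℝ))).const_mul C
    have h3 := h1.add h2
    rwa [div_self hf, sub_self, mul_zero, mul_zero, mul_zero, add_zero] at h3
  · filter_upwards [eventually_ge_atTop t] with n hn
    have hn0 : 0 < n := lt_of_lt_of_le ht0 hn
    have hch : (0 : ℝ) < n.choose t := by exact_mod_cast Nat.choose_pos hn
    have hn' : (n : ℝ) ≠ 0 := by positivity
    refine (hC n hn0).trans (le_of_eq ?_)
    obtain ⟨s, rfl⟩ : ∃ s, t = s + 1 := ⟨t - 1, by omega⟩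
    rw [Nat.add_sub_cancel]
    field_simp
    ring

end FixedDistances

/-! ### Krawtchouk expansion of the annihilating polynomial -/

section KrawtchoukExpansion

/-- The coefficient of `y ^ j` in the power series `(1 + y) ^ M / (1 + 2 * y)`. -/
def kleitmanCoeff : ℕ → ℕ → ℝ
  | 0, j => (-2) ^ j
  | _ + 1, 0 => 1
  | M + 1, j + 1 => kleitmanCoeff M (j + 1) + kleitmanCoeff M j

lemma kleitmanCoeff_zero_right (M : ℕ) : kleitmanCoeff M 0 = 1 := by
  cases M <;> simp [kleitmanCoeff]

lemma kleitmanCoeff_zero_left (j : ℕ) : kleitmanCoeff 0 j = (-2) ^ j := by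
  rw [kleitmanCoeff]

lemma kleitmanCoeff_succ_succ (M j : ℕ) :
    kleitmanCoeff (M + 1) (j + 1) = kleitmanCoeff M (j + 1) + kleitmanCoeff M j := by
  rw [kleitmanCoeff]

lemma kleitmanCoeff_one (M : ℕ) : kleitmanCoeff M 1 = M - 2 := by
  induction M with
  | zero => simp [kleitmanCoeff_zero_left]
  | succ M ih =>
    rw [kleitmanCoeff_succ_succ, ih, kleitmanCoeff_zero_right]
    push_cast
    ring

/-- From the index `M` on, the power series `(1 + y) ^ M / (1 + 2 * y)` is geometric. -/
lemma kleitmanCoeff_add (M k : ℕ) : kleitmanCoeff M (M + k) = (-1) ^ M * (-2) ^ k := by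
  induction M generalizing k with
  | zero => simp [kleitmanCoeff_zero_left]
  | succ M ih =>
    rw [show M + 1 + k = (M + k) + 1 by ring, kleitmanCoeff_succ_succ, ih, add_assoc, ih]
    ring

lemma kleitmanCoeff_succ_self (j : ℕ) : kleitmanCoeff (j + 1) j = (1 + (-1) ^ j) / 2 := by
  induction j with
  | zero => simp [kleitmanCoeff_zero_right]
  | succ j ih =>
    have := kleitmanCoeff_add (j + 1) 0
    rw [kleitmanCoeff_succ_succ, ih]
    rw [add_zero] at this
    rw [this]
    ring

/-- The coefficients entering the expansion for `n ≥ 2 * t + 2` are nonnegative; in the extremal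
case `n = 2 * t + 2` they are alternately `1` and `0`. -/
lemma kleitmanCoeff_nonneg (m j : ℕ) : 0 ≤ kleitmanCoeff (m + 1 + j) j := by
  induction m generalizing j with
  | zero =>
    rw [zero_add, add_comm, kleitmanCoeff_succ_self]
    rcases neg_one_pow_eq_or ℝ j with h | h <;> norm_num [h]
  | succ m ih =>
    induction j with
    | zero => simp [kleitmanCoeff_zero_right]
    | succ j ihj =>
      rw [← add_assoc, kleitmanCoeff_succ_succ]
      refine add_nonneg ?_ ihj
      rw [show m + 1 + 1 + j = m + 1 + (j + 1) by ring]
      exact ih (j + 1)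

/-- The three-term recursion that comes from the differential equation
`(1 + y) * (1 + 2 * y) * f' = (M * (1 + 2 * y) - 2 * (1 + y)) * f` for
`f = (1 + y) ^ M / (1 + 2 * y)`. -/
lemma kleitmanCoeff_recursion (M j : ℕ) :
    (j + 2 : ℝ) * kleitmanCoeff M (j + 2) =
      (M - 5 - 3 * j) * kleitmanCoeff M (j + 1) + (2 * M - 2 - 2 * j) * kleitmanCoeff M j := by
  induction M generalizing j with
  | zero =>
    simp only [kleitmanCoeff_zero_left, Nat.cast_zero]
    ring
  | succ M ih =>
    cases j with
    | zero =>
      have h := ih 0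
      rw [kleitmanCoeff_succ_succ, kleitmanCoeff_succ_succ, kleitmanCoeff_zero_right,
        kleitmanCoeff_zero_right]
      rw [kleitmanCoeff_zero_right] at h
      rw [zero_add, kleitmanCoeff_one] at *
      push_cast at *
      linear_combination h
    | succ j =>
      have h := ih (j + 1)
      have h' := ih j
      rw [kleitmanCoeff_succ_succ, kleitmanCoeff_succ_succ M (j + 1),
        kleitmanCoeff_succ_succ M j]
      push_cast at *
      linear_combination h + h'

/-- `G` satisfies the recursion of the values at `d` of the Krawtchouk polynomials
`K₀, K₁, …` of the `n`-cube, with `u = n - 2 * d`. -/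
structure IsKrawtchoukSeq (n : ℕ) (u : ℝ) (G : ℕ → ℝ) : Prop where
  zero : G 0 = 1
  one : u * G 0 = G 1
  succ : ∀ i : ℕ, u * G (i + 1) = (i + 2) * G (i + 2) + (n - i) * G i

/-- The sequence `G t, G (t - 1), …, G 0, 0, 0, …`. -/
def reversedSeq (G : ℕ → ℝ) (t j : ℕ) : ℝ := if j ≤ t then G (t - j) else 0

lemma reversedSeq_succ_succ (G : ℕ → ℝ) (t j : ℕ) :
    reversedSeq G (t + 1) (j + 1) = reversedSeq G t j := by
  simp [reversedSeq]

lemma IsKrawtchoukSeq.mul_reversedSeq {n : ℕ} {u : ℝ} {G : ℕ → ℝ} (h : IsKrawtchoukSeq n u G)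
    {t j : ℕ} (hj : j ≤ t) :
    u * reversedSeq G (t + 1) (j + 1) = (t - j + 1) * reversedSeq G (t + 1) j +
      (n - t + j + 1) * reversedSeq G (t + 1) (j + 2) := by
  obtain ⟨i, rfl⟩ := Nat.exists_eq_add_of_le hj
  simp only [reversedSeq]
  cases i with
  | zero => simp [show j + 1 - j = 1 by omega, h.one]
  | succ i =>
    rw [if_pos (by omega), if_pos (by omega), if_pos (by omega),
      show j + (i + 1) + 1 - (j + 1) = i + 1 by omega, show j + (i + 1) + 1 - j = i + 2 by omega,
      show j + (i + 1) + 1 - (j + 2) = i by omega, h.succ i]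
    push_cast
    ring

/-- Multiplication by `2 * (2 * t + 2 - d) = 4 * t + 4 - n + u` in terms of the coefficients. -/
lemma IsKrawtchoukSeq.mul_sum_reversedSeq {n m t : ℕ} {u : ℝ} {G : ℕ → ℝ}
    (h : IsKrawtchoukSeq n u G) (hn : n = 2 * t + 3 + m) :
    (4 * t + 4 - n + u) *
      ∑ j ∈ range (t + 1), (-1) ^ j * kleitmanCoeff (m + 2 + j) j * reversedSeq G t j =
    (t + 1) * ∑ j ∈ range (t + 2),
      (-1) ^ j * kleitmanCoeff (m + j) j * reversedSeq G (t + 1) j := by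
  set H := reversedSeq G (t + 1)
  set b : ℕ → ℝ := fun j => (-1) ^ j * kleitmanCoeff (m + 2 + j) j with hb
  set b' : ℕ → ℝ := fun j => (-1) ^ j * kleitmanCoeff (m + j) j with hb'
  have hn' : (n : ℝ) = 2 * t + 3 + m := by rw [hn]; push_cast; ring
  -- comparison of the coefficients of `H (k + 2)` and `H 1`; that of `H 0` is `t + 1` on both sides
  have hcoef : ∀ k : ℕ, (t + 1) * b' (k + 2) - b (k + 2) * (t - k - 1) =
      b k * (n - t + k + 1) + b (k + 1) * (4 * t + 4 - n) := by
    intro k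
    have hrec := kleitmanCoeff_recursion (m + k + 2) k
    simp only [hb, hb']
    rw [show m + 2 + (k + 2) = m + k + 2 + 1 + 1 by ring,
      show m + 2 + (k + 1) = m + k + 2 + 1 by ring,
      kleitmanCoeff_succ_succ (m + k + 2 + 1) (k + 1), kleitmanCoeff_succ_succ (m + k + 2) (k + 1),
      kleitmanCoeff_succ_succ (m + k + 2) k,
      show m + 2 + k = m + k + 2 by ring, show m + (k + 2) = m + k + 2 by ring, hn']
    push_cast at hrec
    rw [pow_add, pow_succ]
    linear_combination (-1) ^ k * hrec
  have hcoef1 : (t + 1) * b' 1 - b 1 * t = b 0 * (4 * t + 4 - n) := by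
    simp only [hb, hb', kleitmanCoeff_one, kleitmanCoeff_zero_right, hn']
    push_cast
    ring
  -- the partial sums, with the boundary terms in `H (k + 1)` and `H (k + 2)`
  have hpart : ∀ k ≤ t, (4 * t + 4 - n + u) * ∑ j ∈ range (k + 1), b j * H (j + 1) =
      (t + 1) * ∑ j ∈ range (k + 1), b' j * H j +
        ((t + 1) * b' (k + 1) - b (k + 1) * (t - k)) * H (k + 1) +
        b k * (n - t + k + 1) * H (k + 2) := by
    intro k
    induction k with
    | zero =>
      intro _
      have h0 := h.mul_reversedSeq (Nat.zero_le t)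
      have hb0 : b 0 = 1 := by simp [hb, kleitmanCoeff_zero_right]
      have hb'0 : b' 0 = 1 := by simp [hb', kleitmanCoeff_zero_right]
      simp only [zero_add, sum_range_one, Nat.cast_zero, sub_zero, add_zero] at h0 ⊢
      rw [hcoef1, hb0, hb'0]
      linear_combination h0
    | succ k ih =>
      intro hk
      have h0 := h.mul_reversedSeq hk
      rw [sum_range_succ, sum_range_succ (fun j => b' j * H j), mul_add, ih (by omega)]
      have hc := hcoef k
      push_cast at h0 ⊢
      have hc' : (t + 1) * b' (k + 1 + 1) - b (k + 1 + 1) * (t - (k + 1)) =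
        b k * (n - t + k + 1) + b (k + 1) * (4 * t + 4 - n) := by
        rw [← hc]
        ring
      rw [hc']
      linear_combination b (k + 1) * h0
  have hlast : H (t + 2) = 0 := by
    simp [H, reversedSeq]
  have := hpart t le_rfl
  rw [hlast] at this
  calc _ = (4 * t + 4 - n + u) * ∑ j ∈ range (t + 1), b j * H (j + 1) := by
        simp only [H, reversedSeq_succ_succ, hb]
    _ = _ := by
        rw [this, sum_range_succ (fun j => b' j * H j) (t + 1)]
        ring

/-- The expansion of `∏ᵢ 2 * (2 * i - d)`, `1 ≤ i ≤ t`, in Krawtchouk polynomials. -/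
lemma IsKrawtchoukSeq.prod_eq_sum {n m t : ℕ} {d : ℝ} {G : ℕ → ℝ}
    (h : IsKrawtchoukSeq n (n - 2 * d) G) (hn : n = 2 * t + 1 + m) :
    ∏ i ∈ range t, 2 * (2 * (i + 1) - d) =
      t.factorial * ∑ j ∈ range (t + 1),
        (-1) ^ j * kleitmanCoeff (m + j) j * reversedSeq G t j := by
  induction t generalizing m with
  | zero => simp [reversedSeq, kleitmanCoeff_zero_right, h.zero]
  | succ t ih =>
    have h1 := h.mul_sum_reversedSeq (m := m) (t := t) (by omega)
    rw [prod_range_succ, ih (m := m + 2) (by omega), Nat.factorial_succ]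
    push_cast
    linear_combination (t.factorial : ℝ) * h1

open Polynomial in
/-- The coefficients of `(1 - X) ^ d * (1 + X) ^ (n - d)` are the values of the Krawtchouk
polynomials at `d`. -/
lemma isKrawtchoukSeq_coeff (d e : ℕ) :
    IsKrawtchoukSeq (d + e) (((d + e : ℕ) : ℝ) - 2 * d)
      fun i => ((1 - X : ℝ[X]) ^ d * (1 + X) ^ e).coeff i := by
  set P : ℝ[X] := (1 - X) ^ d * (1 + X) ^ e with hP
  have hode : derivative P - derivative P * X * X =
      C ((e : ℝ) - d) * P - C ((d : ℝ) + e) * (P * X) := by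
    have h1 : (1 - X : ℝ[X]) * derivative ((1 - X : ℝ[X]) ^ d) = - C (d : ℝ) * (1 - X) ^ d := by
      cases d with
      | zero => simp
      | succ d =>
        rw [derivative_pow_succ]
        simp only [derivative_sub, derivative_one, derivative_X]
        push_cast
        simp only [map_add, map_natCast, map_one]
        ring
    have h2 : (1 + X : ℝ[X]) * derivative ((1 + X : ℝ[X]) ^ e) = C (e : ℝ) * (1 + X) ^ e := by
      cases e with
      | zero => simp
      | succ e =>
        rw [derivative_pow_succ]
        simp only [derivative_add, derivative_one, derivative_X]
        push_cast
        simp only [map_add, map_natCast, map_one]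
        ring
    rw [hP, derivative_mul, C_sub, C_add]
    linear_combination (1 + X) ^ e * (1 + X) * h1 + (1 - X) ^ d * (1 - X) * h2
  have hc := fun k => congrArg (fun Q : ℝ[X] => Q.coeff k) hode
  simp only [coeff_sub, coeff_C_mul] at hc
  refine ⟨?_, ?_, fun i => ?_⟩
  · simp [coeff_zero_eq_eval_zero, hP]
  · have := hc 0
    simp only [mul_coeff_zero, coeff_X_zero, mul_zero, coeff_derivative] at this
    push_cast at *
    linarith
  · have := hc (i + 1)
    cases i with
    | zero =>
      simp only [coeff_mul_X, mul_coeff_zero, coeff_X_zero, mul_zero, coeff_derivative] at this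
      push_cast at *
      linarith
    | succ i =>
      simp only [coeff_mul_X, coeff_derivative] at this
      push_cast at *
      linarith

end KrawtchoukExpansion

/-! ### Characters of the cube -/

section Characters

variable {α : Type*} [DecidableEq α]

/-- The value at the point with support `x` of the character of the Hamming cube attached to
`s`. -/
def cubeChar (s x : Finset α) : ℝ := ∏ i ∈ s, if i ∈ x then -1 else 1

lemma cubeChar_symmDiff (s x y : Finset α) :
    cubeChar s (x ∆ y) = cubeChar s x * cubeChar s y := by
  rw [cubeChar, cubeChar, cubeChar, ← prod_mul_distrib]
  refine prod_congr rfl fun i _ => ?_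
  by_cases hx : i ∈ x <;> by_cases hy : i ∈ y <;> simp [mem_symmDiff, hx, hy]

open Polynomial in
/-- The sum of the characters of degree `i` is the `i`-th Krawtchouk polynomial. -/
lemma coeff_eq_sum_cubeChar {n : ℕ} (z : Finset (Fin n)) (i : ℕ) :
    ((1 - X : ℝ[X]) ^ #z * (1 + X) ^ #zᶜ).coeff i =
      ∑ s ∈ powersetCard i univ, cubeChar s z := by
  have h1 : (1 - X : ℝ[X]) ^ #z * (1 + X) ^ #zᶜ =
      ∏ k : Fin n, (1 + C (if k ∈ z then (-1 : ℝ) else 1) * X) := by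
    rw [← prod_mul_prod_compl z]
    congr 1
    · rw [← prod_const]
      refine prod_congr rfl fun k hk => ?_
      rw [if_pos hk, C_neg, C_1]
      ring
    · rw [← prod_const]
      refine prod_congr rfl fun k hk => ?_
      rw [if_neg (mem_compl.1 hk), C_1]
      ring
  rw [h1, prod_one_add, finsetSum_coeff, powersetCard_eq_filter, sum_filter]
  refine sum_congr rfl fun s _ => ?_
  rw [prod_mul_distrib, prod_const, ← map_prod, coeff_C_mul, coeff_X_pow, cubeChar]
  simp [eq_comm]

lemma isKrawtchoukSeq_sum_cubeChar {n : ℕ} (z : Finset (Fin n)) :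
    IsKrawtchoukSeq n (n - 2 * #z) fun i => ∑ s ∈ powersetCard i univ, cubeChar s z := by
  have h := isKrawtchoukSeq_coeff #z #zᶜ
  rw [card_add_card_compl, Fintype.card_fin] at h
  simpa only [coeff_eq_sum_cubeChar] using h

/-- The quadratic form of a sum of characters is a sum of squares. -/
lemma sum_mul_sum_cubeChar {n : ℕ} (F : Finset (Finset (Fin n))) (w : Finset (Fin n) → ℝ) (i : ℕ) :
    ∑ x ∈ F, ∑ y ∈ F, w x * w y * ∑ s ∈ powersetCard i univ, cubeChar s (x ∆ y) =
      ∑ s ∈ powersetCard i univ, (∑ x ∈ F, w x * cubeChar s x) ^ 2 := by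
  simp only [mul_sum]
  rw [sum_congr rfl fun x _ => sum_comm, sum_comm]
  refine sum_congr rfl fun s _ => ?_
  rw [sq, sum_mul_sum]
  refine sum_congr rfl fun x _ => sum_congr rfl fun y _ => ?_
  rw [cubeChar_symmDiff]
  ring

end Characters

/-! ### Codes with distances 2, 4, …, 2t -/

section Kleitman

/-- The sets of size at most `t` whose size has the parity of `t`. -/
def parityBall (n t : ℕ) : Finset (Finset (Fin n)) :=
  univ.filter fun s => #s ≤ t ∧ #s % 2 = t % 2

lemma mem_parityBall {n t : ℕ} {s : Finset (Fin n)} :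
    s ∈ parityBall n t ↔ #s ≤ t ∧ #s % 2 = t % 2 := by
  simp [parityBall]

lemma card_parityBall (n t : ℕ) : #(parityBall n t) =
    ∑ i ∈ (range (t + 1)).filter (fun i => i % 2 = t % 2), n.choose i := by
  have hmaps : ∀ s ∈ parityBall n t, #s ∈ (range (t + 1)).filter (fun i => i % 2 = t % 2) := by
    intro s hs
    rw [mem_parityBall] at hs
    rw [mem_filter, mem_range]
    exact ⟨by omega, hs.2⟩
  rw [card_eq_sum_card_fiberwise hmaps]
  refine sum_congr rfl fun i hi => ?_
  rw [mem_filter, mem_range] at hi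
  have : (parityBall n t).filter (fun s => #s = i) = powersetCard i univ := by
    ext s
    rw [mem_filter, mem_parityBall, mem_powersetCard_univ]
    constructor
    · exact fun h => h.2
    · rintro rfl
      exact ⟨⟨by omega, hi.2⟩, rfl⟩
  rw [this, card_powersetCard, card_univ, Fintype.card_fin]

/-- If a weight `w` on `F` is orthogonal to all characters in `parityBall n t`, then it vanishes:
the quadratic form `∑ w x * w y * p #(x ∆ y)` with `p d = ∏ 2 * (2 * i - d)` equals
`p 0 * ∑ w x ^ 2`, and in its expansion in characters all remaining terms are nonpositive. -/
lemma eq_zero_of_orthogonal_parityBall {n t : ℕ} (hn : 2 * t + 2 ≤ n)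
    {F : Finset (Finset (Fin n))} (hF : EvenDistancesIn (Icc 1 t) F) (w : Finset (Fin n) → ℝ)
    (hw : ∀ s ∈ parityBall n t, ∑ x ∈ F, w x * cubeChar s x = 0) : ∀ x ∈ F, w x = 0 := by
  obtain ⟨m, hm⟩ := Nat.exists_eq_add_of_le hn
  set p : ℝ → ℝ := fun d => ∏ i ∈ range t, 2 * (2 * (i + 1) - d) with hp
  have hp0 : 0 < p 0 := prod_pos fun i _ => by rw [sub_zero]; positivity
  have hdiag : ∑ x ∈ F, ∑ y ∈ F, w x * w y * p #(x ∆ y) = p 0 * ∑ x ∈ F, w x ^ 2 := by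
    rw [mul_sum]
    refine sum_congr rfl fun x hx => ?_
    rw [sum_eq_single_of_mem x hx]
    · simp only [symmDiff_self, bot_eq_empty, card_empty, Nat.cast_zero]
      ring
    · intro y hy hyx
      obtain ⟨a, ha, hd⟩ := hF x hx y hy hyx.symm
      rw [mem_Icc] at ha
      have : p #(x ∆ y) = 0 := by
        refine prod_eq_zero (mem_range.2 (by omega : a - 1 < t)) ?_
        rw [hd]
        push_cast [Nat.cast_sub ha.1]
        ring
      rw [this, mul_zero]
  have hexp : ∑ x ∈ F, ∑ y ∈ F, w x * w y * p #(x ∆ y) =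
      t.factorial * ∑ j ∈ range (t + 1), (-1) ^ j * kleitmanCoeff (m + 1 + j) j *
        ∑ s ∈ powersetCard (t - j) univ, (∑ x ∈ F, w x * cubeChar s x) ^ 2 := by
    have hpz : ∀ z : Finset (Fin n), p #z = t.factorial * ∑ j ∈ range (t + 1),
        (-1) ^ j * kleitmanCoeff (m + 1 + j) j * ∑ s ∈ powersetCard (t - j) univ, cubeChar s z := by
      intro z
      rw [hp]
      simp only
      rw [(isKrawtchoukSeq_sum_cubeChar z).prod_eq_sum (m := m + 1) (t := t) (by omega)]
      congr 1
      refine sum_congr rfl fun j hj => ?_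
      rw [mem_range] at hj
      rw [reversedSeq, if_pos (by omega)]
    calc ∑ x ∈ F, ∑ y ∈ F, w x * w y * p #(x ∆ y)
        = ∑ x ∈ F, ∑ y ∈ F, ∑ j ∈ range (t + 1), t.factorial *
            ((-1) ^ j * kleitmanCoeff (m + 1 + j) j *
              (w x * w y * ∑ s ∈ powersetCard (t - j) univ, cubeChar s (x ∆ y))) := by
          refine sum_congr rfl fun x _ => sum_congr rfl fun y _ => ?_
          rw [hpz, ← mul_assoc, mul_sum]
          exact sum_congr rfl fun j _ => by ring
      _ = ∑ j ∈ range (t + 1), ∑ x ∈ F, ∑ y ∈ F, t.factorial *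
            ((-1) ^ j * kleitmanCoeff (m + 1 + j) j *
              (w x * w y * ∑ s ∈ powersetCard (t - j) univ, cubeChar s (x ∆ y))) := by
          rw [sum_congr rfl fun x _ => sum_comm, sum_comm]
      _ = _ := by
          rw [mul_sum]
          refine sum_congr rfl fun j _ => ?_
          rw [← sum_mul_sum_cubeChar, ← mul_assoc, mul_sum]
          refine sum_congr rfl fun x _ => ?_
          rw [mul_sum]
          exact sum_congr rfl fun y _ => by ring
  have hnonpos : ∑ x ∈ F, ∑ y ∈ F, w x * w y * p #(x ∆ y) ≤ 0 := by
    rw [hexp]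
    refine mul_nonpos_of_nonneg_of_nonpos (by positivity) (sum_nonpos fun j hj => ?_)
    rw [mem_range] at hj
    rcases Nat.even_or_odd j with he | ho
    · refine le_of_eq (mul_eq_zero_of_right _ (sum_eq_zero fun s hs => ?_))
      rw [mem_powersetCard_univ] at hs
      rw [Nat.even_iff] at he
      rw [hw s (mem_parityBall.2 (by omega)), sq, mul_zero]
    · rw [ho.neg_one_pow, neg_one_mul, neg_mul]
      refine neg_nonpos.2 (mul_nonneg (kleitmanCoeff_nonneg m j) ?_)
      exact sum_nonneg fun s _ => sq_nonneg _
  rw [hdiag] at hnonpos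
  have hsum : ∑ x ∈ F, w x ^ 2 = 0 :=
    le_antisymm (nonpos_of_mul_nonpos_right hnonpos hp0) (sum_nonneg fun x _ => sq_nonneg _)
  intro x hx
  exact pow_eq_zero_iff two_ne_zero |>.1
    ((sum_eq_zero_iff_of_nonneg fun x _ => sq_nonneg (w x)).1 hsum x hx)

lemma EvenDistancesIn.card_le_card_parityBall {n t : ℕ} (hn : 2 * t + 2 ≤ n)
    {F : Finset (Finset (Fin n))} (hF : EvenDistancesIn (Icc 1 t) F) :
    #F ≤ #(parityBall n t) := by
  by_contra! hlt
  -- a weight orthogonal to all characters in `parityBall n t` exists for dimension reasons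
  let φ : (F → ℝ) →ₗ[ℝ] (parityBall n t → ℝ) :=
    LinearMap.pi fun s => ∑ x : F, cubeChar s.1 x.1 • LinearMap.proj x
  have hker : LinearMap.ker φ ≠ ⊥ := LinearMap.ker_ne_bot_of_finrank_lt (by simpa using hlt)
  obtain ⟨v, hv, hv0⟩ := Submodule.exists_mem_ne_zero_of_ne_bot hker
  apply hv0
  have hzero := eq_zero_of_orthogonal_parityBall hn hF
    (fun x => if h : x ∈ F then v ⟨x, h⟩ else 0) (by
      intro s hs
      have h1 := congrFun (LinearMap.mem_ker.1 hv) ⟨s, hs⟩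
      simp only [φ, LinearMap.pi_apply, LinearMap.sum_apply, LinearMap.smul_apply,
        LinearMap.proj_apply, smul_eq_mul, Pi.zero_apply] at h1
      rw [← h1, ← sum_coe_sort F]
      refine sum_congr rfl fun x _ => ?_
      rw [dif_pos x.2, mul_comm])
  funext x
  simpa [x.2] using hzero x.1 x.2

lemma distanceSet_eq_firstEvens {n t : ℕ} (hn : 2 * t ≤ n) {X : Finset (HammingCube n)}
    (hX : ∀ x, x ∈ X ↔ cubeSupport x ∈ parityBall n t) : distanceSet X = firstEvens t := by
  ext d
  simp only [distanceSet, firstEvens, mem_image, mem_offDiag, mem_Icc, Prod.exists]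
  constructor
  · rintro ⟨x, y, ⟨hx, hy, hxy⟩, rfl⟩
    rw [hX, mem_parityBall] at hx hy
    have h1 := hammingDist_pos.2 hxy
    rw [hammingDist_eq_card_symmDiff] at h1 ⊢
    have h2 := card_symmDiff_add_two_mul_card_inter (cubeSupport x) (cubeSupport y)
    exact ⟨#(cubeSupport x ∆ cubeSupport y) / 2, by omega, by omega⟩
  · rintro ⟨i, hi, rfl⟩
    -- two `t`-sets `a ∪ b` and `a ∪ c` meeting in the `(t - i)`-set `a`
    obtain ⟨a, -, ha⟩ := exists_subset_card_eq (s := (univ : Finset (Fin n))) (n := t - i)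
      (by rw [card_univ, Fintype.card_fin]; omega)
    obtain ⟨b, hb, hbi⟩ := exists_subset_card_eq (s := aᶜ) (n := i)
      (by rw [card_compl, Fintype.card_fin]; omega)
    have hab : Disjoint a b := disjoint_left.2 fun k hk hkb => mem_compl.1 (hb hkb) hk
    have hcab : #(a ∪ b) = t := by rw [card_union_of_disjoint hab]; omega
    obtain ⟨c, hc, hci⟩ := exists_subset_card_eq (s := (a ∪ b)ᶜ) (n := i)
      (by rw [card_compl, Fintype.card_fin]; omega)
    have hcd : Disjoint (a ∪ b) c := disjoint_left.2 fun k hk hkc => mem_compl.1 (hc hkc) hk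
    rw [disjoint_union_left] at hcd
    have hcac : #(a ∪ c) = t := by rw [card_union_of_disjoint hcd.1]; omega
    have hinter : (a ∪ b) ∩ (a ∪ c) = a := by
      rw [← union_inter_distrib_left, disjoint_iff_inter_eq_empty.1 hcd.2, union_empty]
    have hd := card_symmDiff_add_two_mul_card_inter (a ∪ b) (a ∪ c)
    rw [hinter] at hd
    obtain ⟨x, hx⟩ := cubeSupport_surjective n (a ∪ b)
    obtain ⟨y, hy⟩ := cubeSupport_surjective n (a ∪ c)
    have hdist : hammingDist x y = 2 * i := by
      rw [hammingDist_eq_card_symmDiff, hx, hy]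
      omega
    refine ⟨x, y, ⟨?_, ?_, hammingDist_pos.1 (by omega)⟩, hdist⟩
    · rw [hX, hx, mem_parityBall, hcab]
      exact ⟨le_rfl, rfl⟩
    · rw [hX, hy, mem_parityBall, hcac]
      exact ⟨le_rfl, rfl⟩

lemma maxCodeSize_firstEvens {n t : ℕ} (hn : 2 * t + 2 ≤ n) :
    maxCodeSize n (firstEvens t) = #(parityBall n t) := by
  classical
  refine le_antisymm (Finset.sup_le fun X hX => ?_) ?_
  · rw [← card_image_cubeSupport]
    refine EvenDistancesIn.card_le_card_parityBall hn fun x hx y hy hxy => ?_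
    have h := card_symmDiff_mem_of_distanceSet_eq (mem_filter.1 hX).2 hx hy hxy
    obtain ⟨a, ha, hd⟩ := mem_image.1 h
    exact ⟨a, ha, hd.symm⟩
  · set X : Finset (HammingCube n) := univ.filter fun x => cubeSupport x ∈ parityBall n t with hXdef
    have hX : ∀ x, x ∈ X ↔ cubeSupport x ∈ parityBall n t := by simp [hXdef]
    have himage : X.image cubeSupport = parityBall n t := by
      ext s
      obtain ⟨x, rfl⟩ := cubeSupport_surjective n s
      rw [mem_image]
      constructor
      · rintro ⟨y, hy, hyx⟩
        rw [← hyx]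
        exact (hX y).1 hy
      · exact fun h => ⟨x, (hX x).2 h, rfl⟩
    rw [← himage, card_image_cubeSupport]
    exact Finset.le_sup (f := card)
      (mem_filter.2 ⟨mem_univ X, distanceSet_eq_firstEvens (by omega) hX⟩)

end Kleitman

end FewDistances

theorem theorem1p2 (t : ℕ) :
    (∀ D : Finset ℕ, (∀ d ∈ D, 0 < d) → D.card = t → D ≠ firstEvens t →
      ∃ ε : ℕ → ℝ, Filter.Tendsto ε Filter.atTop (nhds 0) ∧
        ∀ᶠ n : ℕ in Filter.atTop,
          (maxCodeSize n D : ℝ) ≤ ((t : ℝ) / ((t : ℝ) + 1) + ε n) * (n.choose t : ℝ)) ∧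
    (∀ n : ℕ, 2 * t + 2 ≤ n →
      maxCodeSize n (firstEvens t) =
        ∑ i ∈ (Finset.range (t + 1)).filter (fun i => i % 2 = t % 2), n.choose i) := by
  refine ⟨fun D hD ht hne => exists_maxCodeSize_asymptotic_bound hD ht hne, fun n hn => ?_⟩
  rw [maxCodeSize_firstEvens hn, card_parityBall]
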